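/- All representations are over $\mathbb{C}$. Let $G$ be a finite group and let $D(G)$ be its Drinfel'd double, i.e. the Hopf algebra with basis $e_g\# x$ ($g,x\in G$), product $(e_g\# x)(e_h\# y)=\delta_{g,xhx^{-1}}\,e_g\# xy$, coproduct $\Delta(e_g\# x)=\sum_{ab=g}(e_a\# x)\otimes(e_b\# x)$ and counit $\varepsilon(e_g\# x)=\delta_{g,1}$. Let $\Lambda$ be its normalized integral (the unique two-sided integral with $\varepsilon(\Lambda)=1$). For $h\in D(G)$ and a positive integer $n$ write $h^{[n]}=h_1h_2\cdots h_n$ in Sweedler notation. The $n$-th Frobenius--Schur indicator of an irreducible representation $V$ of $D(G)$ with character $\chi$ is $\nu_n(V)=\chi(\Lambda^{[n]})$. The group $G$ is called FSZ if $\nu_n(V)\in\mathbb{Z}$ for every positive integer $n$ and every irreducible representation $V$ of $D(G)$. A $p$-group $P$ is called regular (P. Hall) if for all $a,b\in P$ and every power $n=p^{\alpha}$ ($\alpha\ge 0$) there are elements $s_1,\dots,s_t$ of the commutator subgroup of $\langle a,b\rangle$ with $(ab)^n=a^nb^ns_1^n\cdots s_t^n$. A finite group $G$ is called a regular CN-group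 if the centralizer in $G$ of every nonidentity element is a direct product of finitely many regular $p$-groups (where the prime $p$ may depend on the factor), and a regular nilpotent group if it is nilpotent and all of its Sylow subgroups are regular. Then every regular CN-group is FSZ, and every regular nilpotent group is FSZ. -/

import Mathlib

open scoped TensorProduct

universe u v

noncomputable section

/-! # Frobenius–Schur indicators of Hopf algebras over the complex numbers -/

section Indicators

variable (H : Type u) [Ring H] [HopfAlgebra ℂ H]

/-- The Sweedler power `h ↦ h^{[n]} = h₁ h₂ ⋯ hₙ`, as a linear endomorphism of `H`
(with `h^{[0]} = ε(h) 1` and `h^{[n+1]} = (h₁)^{[n]} h₂`). -/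
def sweedlerPow : ℕ → (H →ₗ[ℂ] H)
  | 0 => Algebra.linearMap ℂ H ∘ₗ Coalgebra.counit
  | n + 1 => LinearMap.mul' ℂ H ∘ₗ (sweedlerPow n).rTensor H ∘ₗ Coalgebra.comul

variable {H}

/-- `Λ` is a normalized (two-sided) integral of `H`. -/
structure IsNormalizedIntegral (Λ : H) : Prop where
  mul_left : ∀ h : H, h * Λ = (Coalgebra.counit h : ℂ) • Λ
  mul_right : ∀ h : H, Λ * h = (Coalgebra.counit h : ℂ) • Λ
  counit_eq_one : (Coalgebra.counit Λ : ℂ) = 1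

/-- A normalized integral is unique. -/
theorem IsNormalizedIntegral.unique {Λ M : H} (hΛ : IsNormalizedIntegral Λ)
    (hM : IsNormalizedIntegral M) : Λ = M := by
  have h1 := hM.mul_left Λ
  have h2 := hΛ.mul_right M
  rw [hΛ.counit_eq_one, one_smul] at h1
  rw [hM.counit_eq_one, one_smul] at h2
  exact h2.symm.trans h1

/-- The character of an `H`-module `V` over the complex numbers: `h` is sent to the trace of the
action of `h` on `V`. -/
def moduleCharacter (V : Type v) [AddCommGroup V] [Module ℂ V] [Module H V]
    [IsScalarTower ℂ H V] (h : H) : ℂ :=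
  LinearMap.trace ℂ V (Algebra.lsmul ℂ ℂ V h)

/-- The `n`-th Frobenius–Schur indicator `χ(Λ^{[n]})` of an `H`-module `V`, where `χ` is the
character of `V` and `Λ` is the normalized integral of `H`. -/
def frobeniusSchurIndicator (Λ : H) (n : ℕ) (V : Type v) [AddCommGroup V] [Module ℂ V]
    [Module H V] [IsScalarTower ℂ H V] : ℂ :=
  moduleCharacter V (sweedlerPow H n Λ)

end Indicators

/-! # The Drinfel'd double of a finite group -/

/-- The underlying space of the Drinfel'd double `D(G) = ℂ^G ⋊ ℂG` of a finite group `G`.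
The element `f` stands for `∑ g x, f.coeff g x • (e_g # x)`, where `e_g` is the indicator function
of `g`. -/
@[ext]
structure DrinfeldDouble (G : Type u) : Type u where
  /-- The coefficient of `e_g # x`. -/
  coeff : G → G → ℂ

namespace DrinfeldDouble

section Linear

variable {G : Type u}

/-- The coefficient function determines the element. -/
def coeffEquiv : DrinfeldDouble G ≃ (G → G → ℂ) where
  toFun := coeff
  invFun := mk
  left_inv _ := rfl
  right_inv _ := rfl

instance : AddCommGroup (DrinfeldDouble G) := coeffEquiv.addCommGroup
instance : Module ℂ (DrinfeldDouble G) := coeffEquiv.module ℂ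

open Classical in
/-- The basis element `e_g # x` of `D(G)`. -/
def basisElt (g x : G) : DrinfeldDouble G := ⟨fun h y => if h = g ∧ y = x then 1 else 0⟩

open Classical in
theorem coeff_basisElt (g x h y : G) :
    (basisElt g x).coeff h y = if h = g ∧ y = x then 1 else 0 := rfl

theorem ext_coeff {f f' : DrinfeldDouble G} (h : ∀ g x, f.coeff g x = f'.coeff g x) : f = f' :=
  DrinfeldDouble.ext (funext fun g => funext fun x => h g x)

theorem coeff_add (f f' : DrinfeldDouble G) (g x : G) :
    (f + f').coeff g x = f.coeff g x + f'.coeff g x := rfl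

theorem coeff_zero (g x : G) : (0 : DrinfeldDouble G).coeff g x = 0 := rfl

theorem coeff_smul (c : ℂ) (f : DrinfeldDouble G) (g x : G) :
    (c • f).coeff g x = c * f.coeff g x := rfl

/-- The coefficient of `e_g # x`, as a linear map. -/
def coeffLin (g x : G) : DrinfeldDouble G →ₗ[ℂ] ℂ where
  toFun f := f.coeff g x
  map_add' _ _ := rfl
  map_smul' _ _ := rfl

theorem coeffLin_apply (g x : G) (f : DrinfeldDouble G) : coeffLin g x f = f.coeff g x := rfl

theorem coeff_sum {ι : Type*} (s : Finset ι) (F : ι → DrinfeldDouble G) (g x : G) :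
    (∑ i ∈ s, F i).coeff g x = ∑ i ∈ s, (F i).coeff g x :=
  map_sum (coeffLin g x) F s

end Linear

variable {G : Type u}
section Unit

variable [Group G]

open Classical in
/-- The unit `∑ g, e_g # 1` of `D(G)`. -/
instance : One (DrinfeldDouble G) where
  one := ⟨fun _ x => if x = 1 then 1 else 0⟩

open Classical in
theorem coeff_one (g x : G) : (1 : DrinfeldDouble G).coeff g x = if x = 1 then 1 else 0 := rfl

end Unit

variable [Fintype G]

theorem eq_sum (f : DrinfeldDouble G) : f = ∑ g, ∑ x, f.coeff g x • basisElt g x := by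
  classical
  refine ext_coeff fun h y => ?_
  simp only [coeff_sum, coeff_smul, basisElt]
  rw [Finset.sum_eq_single h, Finset.sum_eq_single y]
  · simp
  · intro b _ hb; simp [hb.symm]
  · simp
  · intro b _ hb; simp [hb.symm]
  · simp

theorem linearMap_ext {M : Type*} [AddCommGroup M] [Module ℂ M]
    {φ ψ : DrinfeldDouble G →ₗ[ℂ] M} (h : ∀ g x, φ (basisElt g x) = ψ (basisElt g x)) :
    φ = ψ := by
  refine LinearMap.ext fun f => ?_
  rw [eq_sum f]
  simp only [map_sum, map_smul, h]

variable [Group G]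

/-- Multiplication of `D(G)`: on the basis it is
`(e_g # x) (e_h # y) = δ_{g, x h x⁻¹} (e_g # x y)`, see `basisElt_mul_basisElt`. -/
instance : Mul (DrinfeldDouble G) where
  mul f f' := ⟨fun g z => ∑ x, f.coeff g x * f'.coeff (x⁻¹ * g * x) (x⁻¹ * z)⟩

theorem coeff_mul (f f' : DrinfeldDouble G) (g z : G) :
    (f * f').coeff g z = ∑ x, f.coeff g x * f'.coeff (x⁻¹ * g * x) (x⁻¹ * z) := rfl

instance : Ring (DrinfeldDouble G) where
  __ := (inferInstance : AddCommGroup (DrinfeldDouble G))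
  mul_assoc f f' f'' := ext_coeff fun g z => by
    simp only [coeff_mul, Finset.sum_mul, Finset.mul_sum]
    rw [Finset.sum_comm]
    refine Finset.sum_congr rfl fun x _ => ?_
    rw [← Equiv.sum_comp (Equiv.mulLeft x)]
    refine Finset.sum_congr rfl fun w _ => ?_
    simp [mul_assoc]
  one_mul f := ext_coeff fun g z => by
    classical
    simp [coeff_mul, coeff_one]
  mul_one f := ext_coeff fun g z => by
    rw [coeff_mul, Finset.sum_eq_single z]
    · simp [coeff_one]
    · intro b _ hb; simp [coeff_one, inv_mul_eq_one, hb]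
    · simp
  left_distrib f f' f'' := ext_coeff fun g z => by
    simp [coeff_mul, coeff_add, mul_add, Finset.sum_add_distrib]
  right_distrib f f' f'' := ext_coeff fun g z => by
    simp [coeff_mul, coeff_add, add_mul, Finset.sum_add_distrib]
  zero_mul f := ext_coeff fun g z => by simp [coeff_mul, coeff_zero]
  mul_zero f := ext_coeff fun g z => by simp [coeff_mul, coeff_zero]

instance : Algebra ℂ (DrinfeldDouble G) :=
  Algebra.ofModule
    (fun c f f' => ext_coeff fun g z => by
      simp [coeff_mul, coeff_smul, Finset.mul_sum, mul_assoc])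
    (fun c f f' => ext_coeff fun g z => by
      simp [coeff_mul, coeff_smul, Finset.mul_sum, mul_left_comm])

open Classical in
theorem basisElt_mul_basisElt (g x h y : G) :
    basisElt g x * basisElt h y = if g = x * h * x⁻¹ then basisElt g (x * y) else 0 := by
  refine ext_coeff fun k z => ?_
  rw [coeff_mul, Finset.sum_eq_single x]
  · simp only [coeff_basisElt]
    by_cases hk : k = g
    · subst hk
      have e1 : (x⁻¹ * k * x = h) ↔ (k = x * h * x⁻¹) := by
        constructor
        · rintro rfl; group
        · intro e; rw [e]; group
      by_cases hh : k = x * h * x⁻¹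
      · simp only [e1, inv_mul_eq_iff_eq_mul]
        rw [if_pos hh]
        simp [coeff_basisElt, hh]
      · simp only [e1]
        rw [if_neg hh]
        simp [coeff_zero, hh]
    · split_ifs <;> simp_all [coeff_basisElt, coeff_zero]
  · intro b _ hb; simp [coeff_basisElt, hb]
  · simp

theorem one_eq_sum : (1 : DrinfeldDouble G) = ∑ g, basisElt g 1 := by
  classical
  refine ext_coeff fun g x => ?_
  simp only [coeff_sum, coeff_basisElt, coeff_one]
  by_cases hx : x = 1 <;> simp [hx]

/-- Comultiplication of `D(G)`: `Δ(e_g # x) = ∑_{a b = g} (e_a # x) ⊗ (e_b # x)`. -/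
def comulLin : DrinfeldDouble G →ₗ[ℂ] DrinfeldDouble G ⊗[ℂ] DrinfeldDouble G :=
  ∑ g, ∑ x, (coeffLin g x).smulRight (∑ a, basisElt a x ⊗ₜ[ℂ] basisElt (a⁻¹ * g) x)

/-- Counit of `D(G)`: `ε(e_g # x) = δ_{g, 1}`. -/
def counitLin : DrinfeldDouble G →ₗ[ℂ] ℂ := ∑ x, coeffLin 1 x

/-- Antipode of `D(G)`: `S(e_g # x) = e_{x⁻¹ g⁻¹ x} # x⁻¹`, see `antipodeLin_basisElt`. -/
def antipodeLin : DrinfeldDouble G →ₗ[ℂ] DrinfeldDouble G where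
  toFun f := ⟨fun g x => f.coeff (x⁻¹ * g⁻¹ * x) x⁻¹⟩
  map_add' _ _ := rfl
  map_smul' _ _ := rfl

theorem comulLin_basisElt (g x : G) :
    comulLin (basisElt g x) = ∑ a, basisElt a x ⊗ₜ[ℂ] basisElt (a⁻¹ * g) x := by
  classical
  simp only [comulLin, LinearMap.sum_apply, LinearMap.smulRight_apply]
  rw [Finset.sum_eq_single g, Finset.sum_eq_single x]
  · simp [coeffLin_apply, coeff_basisElt]
  · intro b _ hb; simp [coeffLin_apply, coeff_basisElt, hb]
  · simp
  · intro b _ hb; simp [coeffLin_apply, coeff_basisElt, hb]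
  · simp

open Classical in
theorem counitLin_basisElt (g x : G) :
    counitLin (basisElt g x) = if g = 1 then 1 else 0 := by
  simp only [counitLin, LinearMap.sum_apply]
  by_cases hg : g = 1
  · simp [coeffLin_apply, coeff_basisElt, hg]
  · simp [coeffLin_apply, coeff_basisElt, hg, Ne.symm hg]

theorem antipodeLin_basisElt (g x : G) :
    antipodeLin (basisElt g x) = basisElt (x⁻¹ * g⁻¹ * x) x⁻¹ := by
  classical
  refine ext_coeff fun h y => ?_
  change (basisElt g x).coeff (y⁻¹ * h⁻¹ * y) y⁻¹ = _
  simp only [coeff_basisElt]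
  have : (y⁻¹ * h⁻¹ * y = g ∧ y⁻¹ = x) ↔ (h = x⁻¹ * g⁻¹ * x ∧ y = x⁻¹) := by
    constructor
    · rintro ⟨rfl, rfl⟩; constructor <;> group
    · rintro ⟨rfl, rfl⟩; constructor <;> group
  simp only [this]

instance : Coalgebra ℂ (DrinfeldDouble G) where
  comul := comulLin
  counit := counitLin
  coassoc := linearMap_ext fun g x => by
    simp only [LinearMap.comp_apply, comulLin_basisElt, map_sum, LinearMap.rTensor_tmul,
      LinearMap.lTensor_tmul, TensorProduct.sum_tmul, TensorProduct.tmul_sum,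
      LinearEquiv.coe_coe, TensorProduct.assoc_tmul]
    rw [Finset.sum_comm]
    refine Finset.sum_congr rfl fun a _ => ?_
    rw [← Equiv.sum_comp (Equiv.mulLeft a)]
    refine Finset.sum_congr rfl fun b _ => ?_
    simp [mul_assoc]
  rTensor_counit_comp_comul := linearMap_ext fun g x => by
    classical
    simp only [LinearMap.comp_apply, comulLin_basisElt, map_sum, LinearMap.rTensor_tmul,
      counitLin_basisElt, TensorProduct.mk_apply]
    rw [Finset.sum_eq_single 1]
    · simp
    · intro b _ hb; simp [hb]
    · simp
  lTensor_counit_comp_comul := linearMap_ext fun g x => by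
    classical
    simp only [LinearMap.comp_apply, comulLin_basisElt, map_sum, LinearMap.lTensor_tmul,
      counitLin_basisElt, LinearMap.flip_apply, TensorProduct.mk_apply]
    rw [Finset.sum_eq_single g]
    · simp
    · intro b _ hb
      rw [if_neg (by simpa [inv_mul_eq_one] using hb)]; simp
    · simp

theorem comul_basisElt (g x : G) : Coalgebra.comul (R := ℂ) (basisElt g x) =
    ∑ a, basisElt a x ⊗ₜ[ℂ] basisElt (a⁻¹ * g) x := comulLin_basisElt g x

open Classical in
theorem counit_basisElt (g x : G) :
    Coalgebra.counit (R := ℂ) (basisElt g x) = if g = 1 then 1 else 0 := counitLin_basisElt g x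

theorem bilin_ext {M : Type*} [AddCommGroup M] [Module ℂ M]
    {φ ψ : DrinfeldDouble G →ₗ[ℂ] DrinfeldDouble G →ₗ[ℂ] M}
    (h : ∀ g x k y, φ (basisElt g x) (basisElt k y) = ψ (basisElt g x) (basisElt k y)) :
    φ = ψ :=
  linearMap_ext fun g x => linearMap_ext fun k y => h g x k y

instance : Bialgebra ℂ (DrinfeldDouble G) :=
  Bialgebra.mk' ℂ (DrinfeldDouble G)
    (by
      classical
      rw [one_eq_sum]
      simp [map_sum, counit_basisElt])
    (fun {f f'} => by
      classical
      have := bilin_ext (G := G) (M := ℂ)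
        (φ := (LinearMap.mul ℂ (DrinfeldDouble G)).compr₂ (Coalgebra.counit (R := ℂ)))
        (ψ := (LinearMap.mul ℂ ℂ).compl₁₂ (Coalgebra.counit (R := ℂ)) (Coalgebra.counit (R := ℂ)))
        (fun g x k y => by
          simp only [LinearMap.compr₂_apply, LinearMap.compl₁₂_apply, LinearMap.mul_apply_apply,
            basisElt_mul_basisElt, counit_basisElt]
          by_cases hg : g = 1
          · subst hg
            by_cases hk : k = 1
            · subst hk; simp [counit_basisElt]
            · rw [if_neg]
              · simp [hk]
              · intro e; apply hk
                have : k = x⁻¹ * 1 * x := by rw [e]; group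
                simpa using this
          · split_ifs <;> simp_all [counit_basisElt])
      exact LinearMap.congr_fun (LinearMap.congr_fun this f) f')
    (by
      classical
      rw [one_eq_sum]
      simp only [map_sum, comul_basisElt, Algebra.TensorProduct.one_def, one_eq_sum,
        TensorProduct.sum_tmul, TensorProduct.tmul_sum]
      rw [Finset.sum_comm]
      conv_rhs => rw [Finset.sum_comm]
      refine Finset.sum_congr rfl fun a _ => ?_
      rw [← Equiv.sum_comp (Equiv.mulLeft a)]
      simp)
    (fun {f f'} => by
      classical
      have := bilin_ext (G := G)
        (φ := (LinearMap.mul ℂ (DrinfeldDouble G)).compr₂ (Coalgebra.comul (R := ℂ)))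
        (ψ := (LinearMap.mul ℂ (DrinfeldDouble G ⊗[ℂ] DrinfeldDouble G)).compl₁₂
          (Coalgebra.comul (R := ℂ)) (Coalgebra.comul (R := ℂ)))
        (fun g x k y => by
          simp only [LinearMap.compr₂_apply, LinearMap.compl₁₂_apply, LinearMap.mul_apply_apply,
            comul_basisElt, Finset.sum_mul, Finset.mul_sum, Algebra.TensorProduct.tmul_mul_tmul]
          have key : ∀ a b : G, (basisElt a x * basisElt b y) ⊗ₜ[ℂ]
              (basisElt (a⁻¹ * g) x * basisElt (b⁻¹ * k) y) =
              if b = x⁻¹ * a * x then (if g = x * k * x⁻¹ then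
                basisElt a (x * y) ⊗ₜ[ℂ] basisElt (a⁻¹ * g) (x * y) else 0) else 0 := by
            intro a b
            rw [basisElt_mul_basisElt, basisElt_mul_basisElt]
            by_cases hb : b = x⁻¹ * a * x
            · subst hb
              have e1 : a = x * (x⁻¹ * a * x) * x⁻¹ := by group
              have e2 : x * ((x⁻¹ * a * x)⁻¹ * k) * x⁻¹ = a⁻¹ * (x * k * x⁻¹) := by group
              rw [if_pos e1, if_pos rfl, e2]
              simp only [mul_right_inj]
              split_ifs <;> simp
            · rw [if_neg hb, if_neg, TensorProduct.zero_tmul]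
              intro e; apply hb; rw [e]; group
          rw [basisElt_mul_basisElt]
          simp only [key]
          first
          | simp only [Finset.sum_ite_eq', Finset.mem_univ, if_true]
          | (rw [Finset.sum_comm]; simp only [Finset.sum_ite_eq', Finset.mem_univ, if_true])
          split_ifs with hg
          · rw [comul_basisElt]
          · simp)
      exact LinearMap.congr_fun (LinearMap.congr_fun this f) f')

instance : HopfAlgebra ℂ (DrinfeldDouble G) where
  antipode := antipodeLin
  mul_antipode_rTensor_comul := linearMap_ext fun g x => by
    classical
    simp only [LinearMap.comp_apply, comul_basisElt, map_sum, LinearMap.rTensor_tmul,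
      LinearMap.mul'_apply, antipodeLin_basisElt, basisElt_mul_basisElt, counit_basisElt,
      Algebra.linearMap_apply]
    have e : ∀ a : G, x⁻¹ * a⁻¹ * x = x⁻¹ * (a⁻¹ * g) * x⁻¹⁻¹ ↔ g = 1 := by
      intro a
      constructor
      · intro h; simpa [mul_assoc] using h
      · rintro rfl; simp
    simp only [e]
    by_cases hg : g = 1
    · simp only [if_pos hg, map_one, one_eq_sum, inv_mul_cancel]
      let φ : G ≃ G := (Equiv.inv G).trans (MulAut.conj x⁻¹).toEquiv
      rw [← Equiv.sum_comp φ (fun a => basisElt a 1)]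
      refine Finset.sum_congr rfl fun a _ => ?_
      simp [φ]
    · simp [hg]
  mul_antipode_lTensor_comul := linearMap_ext fun g x => by
    classical
    simp only [LinearMap.comp_apply, comul_basisElt, map_sum, LinearMap.lTensor_tmul,
      LinearMap.mul'_apply, antipodeLin_basisElt, basisElt_mul_basisElt, counit_basisElt,
      Algebra.linearMap_apply]
    have e : ∀ a : G, a = x * (x⁻¹ * (a⁻¹ * g)⁻¹ * x) * x⁻¹ ↔ g = 1 := by
      intro a
      constructor
      · intro h; simpa [mul_assoc] using h
      · rintro rfl; group
    simp only [e]
    by_cases hg : g = 1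
    · simp [hg, one_eq_sum]
    · simp [hg]

variable (G) in
/-- The normalized integral `Λ = |G|⁻¹ ∑ x, e_1 # x` of `D(G)`, see `isNormalizedIntegral`. -/
def integral : DrinfeldDouble G := (Fintype.card G : ℂ)⁻¹ • ∑ x, basisElt 1 x

variable (G) in
theorem isNormalizedIntegral : IsNormalizedIntegral (integral G) where
  mul_left h := by
    classical
    have : LinearMap.mulRight ℂ (integral G) =
        (Coalgebra.counit (R := ℂ) (A := DrinfeldDouble G)).smulRight (integral G) := by
      refine linearMap_ext fun g x => ?_
      simp only [LinearMap.mulRight_apply, LinearMap.smulRight_apply, integral, mul_smul_comm,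
        Finset.mul_sum, basisElt_mul_basisElt, counit_basisElt, mul_one, mul_inv_cancel]
      by_cases hg : g = 1
      · subst hg
        simp only [if_true, one_smul]
        rw [← Equiv.sum_comp (Equiv.mulLeft x) (fun y => basisElt 1 y)]
        rfl
      · simp [hg]
    exact LinearMap.congr_fun this h
  mul_right h := by
    classical
    have : LinearMap.mulLeft ℂ (integral G) =
        (Coalgebra.counit (R := ℂ) (A := DrinfeldDouble G)).smulRight (integral G) := by
      refine linearMap_ext fun g x => ?_
      simp only [LinearMap.mulLeft_apply, LinearMap.smulRight_apply, integral, smul_mul_assoc,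
        Finset.sum_mul, basisElt_mul_basisElt, counit_basisElt]
      have e : ∀ y : G, 1 = y * g * y⁻¹ ↔ g = 1 := by
        intro y
        rw [eq_comm, conj_eq_one_iff]
      simp only [e]
      by_cases hg : g = 1
      · subst hg
        simp only [if_true, one_smul]
        rw [← Equiv.sum_comp (Equiv.mulRight x) (fun y => basisElt 1 y)]
        rfl
      · simp [hg]
    exact LinearMap.congr_fun this h
  counit_eq_one := by
    classical
    simp [integral, counit_basisElt, map_sum]

end DrinfeldDouble

/-! # FSZ-groups, regular `p`-groups and regular CN-groups -/

/-- `G` is an `FSZ_n`-group: the `n`-th Frobenius–Schur indicators of all irreducible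
representations `V` of the Drinfel'd double `D(G)` are integers. -/
def IsFSZn (n : ℕ) (G : Type u) [Group G] [Fintype G] : Prop :=
  ∀ (V : Type v) [AddCommGroup V] [Module ℂ V] [Module (DrinfeldDouble G) V]
    [IsScalarTower ℂ (DrinfeldDouble G) V] [IsSimpleModule (DrinfeldDouble G) V],
    ∃ k : ℤ, frobeniusSchurIndicator (DrinfeldDouble.integral G) n V = k

/-- `G` is an `FSZ`-group: it is an `FSZ_n`-group for all positive integers `n`. -/
def IsFSZ (G : Type u) [Group G] [Fintype G] : Prop :=
  ∀ n : ℕ, 0 < n → IsFSZn.{u, v} n G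

/-- `P` is a regular `p`-group in the sense of P. Hall: for all `a`, `b` in `P` and every power
`n` of the prime `p` there are elements `s₁, …, sₜ` of the commutator subgroup of `⟨a, b⟩` with
`(a b)^n = a^n b^n s₁^n ⋯ sₜ^n`. -/
def IsRegularPGroup (p : ℕ) (P : Type u) [Group P] : Prop :=
  p.Prime ∧ IsPGroup p P ∧
    ∀ (a b : P) (α : ℕ), ∃ S : List P,
      (∀ s ∈ S, s ∈ ⁅Subgroup.closure {a, b}, Subgroup.closure {a, b}⁆) ∧
      (a * b) ^ p ^ α = a ^ p ^ α * b ^ p ^ α * (S.map fun s => s ^ p ^ α).prod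

/-- `C` is (isomorphic to) a direct product of finitely many regular `p`-groups, where the primes
`p` may vary with the factor. -/
def IsProdOfRegularPGroups (C : Type u) [Group C] : Prop :=
  ∃ (k : ℕ) (p : Fin k → ℕ) (P : Fin k → Type u) (_ : ∀ i, Group (P i)),
    (∀ i, IsRegularPGroup (p i) (P i)) ∧ Nonempty (C ≃* (∀ i, P i))

/-- `G` is a regular CN-group: the centralizer of every nonidentity element is a direct product
of regular `p`-groups. -/
def IsRegularCNGroup (G : Type u) [Group G] : Prop :=
  ∀ g : G, g ≠ 1 → IsProdOfRegularPGroups (Subgroup.centralizer {g})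

/-- `G` is a regular nilpotent group: it is nilpotent and all of its Sylow subgroups are
regular. -/
def IsRegularNilpotent (G : Type u) [Group G] : Prop :=
  Group.IsNilpotent G ∧ ∀ p : ℕ, p.Prime → ∀ P : Sylow p G, IsRegularPGroup p P

end

/-!
If `P` is a regular `p`-group and `n` is a power of `p`, then `a ^ n = b ^ n` holds exactly when
`(a⁻¹ * b) ^ n = 1`; this survives products, and hence holds for every `n ≠ 0` in the centralizers
of nonidentity elements in the groups considered here. There the fibres of the `n`-th power map are
cosets of its fibre over `1`, so the number of common `n`-th roots `y ^ n = g = (y * u) ^ n` depends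
only on `u` and on the cyclic group generated by `g`. For the Drinfel'd double,
`|G| * ν_n(V) = ∑ u g, #{y | y ^ n = g = (y * u) ^ n} * χ(e_u # g)`,
and the values `χ(e_u # g)` sum to integers over subgroups commuting with `u` (the average of the
`e_u # g` is idempotent there), hence also over the generators of a fixed cyclic subgroup. So
`|G| * ν_n(V)` is an integer. On the other hand `ν_n(V)` is the trace on the tensor power `V^{⊗ n}`
of the action of the integral, an idempotent, composed with the cyclic permutation of the factors,
which commutes with it and has finite order; so `ν_n(V)` is an algebraic integer. A rational
algebraic integer is an integer.
-/

open scoped commutatorElement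

section PowerFibres

variable {P : Type*} [Group P] {n : ℕ}

/-- The `n`-th power is multiplicative on `a, b` as soon as the derived subgroup of `⟨a, b⟩` has
exponent dividing `n`: the case of Hall's regularity in which the factors `sᵢ ^ n` are trivial. -/
def IsWeaklyRegular (n : ℕ) (P : Type*) [Group P] : Prop :=
  ∀ a b : P, (∀ s ∈ ⁅Subgroup.closure {a, b}, Subgroup.closure {a, b}⁆, s ^ n = 1) →
    (a * b) ^ n = a ^ n * b ^ n

/-- The fibres of the `n`-th power map of `P` are left translates of its fibre over `1`. -/
def HasTorsionPowFibers (n : ℕ) (P : Type*) [Group P] : Prop :=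
  ∀ a b : P, a ^ n = b ^ n ↔ (a⁻¹ * b) ^ n = 1

theorem IsRegularPGroup.isWeaklyRegular {p : ℕ} {P : Type u} [Group P] (h : IsRegularPGroup p P)
    (α : ℕ) : IsWeaklyRegular (p ^ α) P := by
  intro a b hs
  obtain ⟨S, hS, hab⟩ := h.2.2 a b α
  have hprod : (S.map fun s => s ^ p ^ α).prod = 1 :=
    List.prod_eq_one (List.forall_mem_map.2 fun s hsS => hs s (hS s hsS))
  rw [hab, hprod, mul_one]

theorem commutator_closure_pair_le {N : Subgroup P} {a b : P}
    (ha : a ∈ Subgroup.normalizer (N : Set P)) (hb : b ∈ Subgroup.normalizer (N : Set P))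
    (hab : ⁅a, b⁆ ∈ N) : ⁅Subgroup.closure {a, b}, Subgroup.closure {a, b}⁆ ≤ N := by
  have hnorm : Subgroup.closure {a, b} ≤ Subgroup.normalizer (N : Set P) :=
    (Subgroup.closure_le _).2 (Set.pair_subset ha hb)
  have hconj {g x : P} (hg : g ∈ Subgroup.closure {a, b}) (hx : x ∈ N) : g * x * g⁻¹ ∈ N :=
    (Subgroup.mem_normalizer_iff.1 (hnorm hg) x).1 hx
  rw [Subgroup.commutator_le]
  intro g hg h hh
  induction hg, hh using Subgroup.closure_induction₂ with
  | mem x y hx hy =>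
    rcases hx with rfl | rfl <;> rcases hy with rfl | rfl
    · simp
    · exact hab
    · simpa using N.inv_mem hab
    · simp
  | one_left => simp
  | one_right => simp
  | mul_left x y z hx hy hz hxz hyz =>
    rw [commutatorElement_mul_left_eq_conj_mul]
    exact N.mul_mem (hconj hx hyz) hxz
  | mul_right y z x hy hz hx hxy hxz =>
    rw [commutatorElement_mul_right_eq_mul_conj]
    simpa only [mul_assoc] using N.mul_mem hxy (hconj hy hxz)
  | inv_left x y hx hy hxy =>
    simpa [commutatorElement_def, mul_assoc] using hconj (inv_mem hx) (N.inv_mem hxy)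
  | inv_right x y hx hy hxy =>
    simpa [commutatorElement_def, mul_assoc] using hconj (inv_mem hy) (N.inv_mem hxy)

/-- The elements of `M` killed by `n`, as a subgroup of the ambient group, when they are closed
under multiplication; it is normalized by whatever normalizes `M`. -/
def torsionSubgroup (M : Subgroup P) (n : ℕ)
    (hmul : ∀ x ∈ M, ∀ y ∈ M, x ^ n = 1 → y ^ n = 1 → (x * y) ^ n = 1) : Subgroup P where
  carrier := {x | x ∈ M ∧ x ^ n = 1}
  one_mem' := ⟨M.one_mem, one_pow n⟩
  mul_mem' hx hy := ⟨M.mul_mem hx.1 hy.1, hmul _ hx.1 _ hy.1 hx.2 hy.2⟩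
  inv_mem' hx := ⟨M.inv_mem hx.1, by rw [inv_pow, hx.2, inv_one]⟩

theorem normalizer_le_normalizer_torsionSubgroup {M : Subgroup P}
    (hmul : ∀ x ∈ M, ∀ y ∈ M, x ^ n = 1 → y ^ n = 1 → (x * y) ^ n = 1) :
    Subgroup.normalizer (M : Set P) ≤ Subgroup.normalizer (torsionSubgroup M n hmul : Set P) := by
  intro g hg
  rw [Subgroup.mem_normalizer_iff] at hg ⊢
  intro x
  refine and_congr (hg x) ?_
  rw [conj_pow, conj_eq_one_iff]

theorem IsWeaklyRegular.mul_pow_of_commutator_mem (hP : IsWeaklyRegular n P) {M : Subgroup P}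
    (hmul : ∀ x ∈ M, ∀ y ∈ M, x ^ n = 1 → y ^ n = 1 → (x * y) ^ n = 1) {a b : P}
    (ha : a ∈ Subgroup.normalizer (M : Set P)) (hb : b ∈ Subgroup.normalizer (M : Set P))
    (hab : ⁅a, b⁆ ∈ M) (habn : ⁅a, b⁆ ^ n = 1) : (a * b) ^ n = a ^ n * b ^ n := by
  have hle : ⁅Subgroup.closure {a, b}, Subgroup.closure {a, b}⁆ ≤ torsionSubgroup M n hmul :=
    commutator_closure_pair_le (normalizer_le_normalizer_torsionSubgroup hmul ha)
      (normalizer_le_normalizer_torsionSubgroup hmul hb) ⟨hab, habn⟩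
  exact hP a b fun s hs => (hle hs).2

/-- Induction on `⟨a, b⟩`: either it is cyclic, or a maximal subgroup `M` containing `b` is normal
in it, and the pairs from `M` generate smaller subgroups. -/
theorem pairwise_of_commute_of_normalizer [Finite P] [Group.IsNilpotent P] {r : P → P → Prop}
    (hcomm : ∀ a b, Commute a b → r a b)
    (hstep : ∀ (a b : P) (M : Subgroup P), b ∈ M → a ∈ Subgroup.normalizer (M : Set P) →
      (∀ x ∈ M, ∀ y ∈ M, r x y) → r a b)
    (a b : P) : r a b := by
  induction hH : Subgroup.closure {a, b} using WellFoundedLT.induction generalizing a b with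
  | _ H ih =>
  have ha : a ∈ H := hH ▸ Subgroup.subset_closure (Set.mem_insert a {b})
  have hb : b ∈ H := hH ▸ Subgroup.subset_closure (Set.mem_insert_of_mem a rfl)
  obtain htop | ⟨K, hK, hbK⟩ := eq_top_or_exists_le_coatom (Subgroup.zpowers (⟨b, hb⟩ : H))
  · obtain ⟨i, hi⟩ := Subgroup.mem_zpowers_iff.1 (htop ▸ Subgroup.mem_top (⟨a, ha⟩ : H))
    obtain rfl : b ^ i = a := congrArg Subtype.val hi
    exact hcomm _ _ (Commute.zpow_self b i)
  · have hKnormal : K.Normal :=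
      Subgroup.NormalizerCondition.normal_of_coatom K Group.normalizerCondition_of_isNilpotent hK
    have hlt : K.map H.subtype < H := by
      calc K.map H.subtype < (⊤ : Subgroup H).map H.subtype :=
            Subgroup.map_subtype_lt_map_subtype.2 hK.lt_top
        _ = H := by rw [← MonoidHom.range_eq_map, H.range_subtype]
    refine hstep a b (K.map H.subtype) ⟨_, Subgroup.zpowers_le.1 hbK, rfl⟩ ?_ ?_
    · refine Subgroup.le_normalizer_map H.subtype ⟨⟨a, ha⟩, ?_, rfl⟩
      rw [Subgroup.normalizer_eq_top]
      exact Subgroup.mem_top _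
    · intro x hx y hy
      exact ih _ (((Subgroup.closure_le _).2 (Set.pair_subset hx hy)).trans_lt hlt) x y rfl

variable [Finite P] [Group.IsNilpotent P]

theorem IsWeaklyRegular.mul_pow_of_pow_eq_one (hP : IsWeaklyRegular n P) (a b : P) :
    b ^ n = 1 → (a * b) ^ n = a ^ n := by
  induction a, b using pairwise_of_commute_of_normalizer with
  | hcomm a b hab =>
    intro hb
    rw [hab.mul_pow, hb, mul_one]
  | hstep a b M hbM haM ih =>
    intro hb
    have hcb : a * b * a⁻¹ ∈ M := (Subgroup.mem_normalizer_iff.1 haM b).1 hbM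
    have hcomm : ⁅a, b⁆ ^ n = 1 := by
      rw [commutatorElement_def, ih _ hcb _ (M.inv_mem hbM) (by rw [inv_pow, hb, inv_one]),
        conj_pow, hb, conj_eq_one_iff]
    rw [hP.mul_pow_of_commutator_mem (fun x hx y hy hxn hyn => (ih x hx y hy hyn).trans hxn) haM
      (Subgroup.le_normalizer hbM) (M.mul_mem hcb (M.inv_mem hbM)) hcomm, hb, mul_one]

theorem IsWeaklyRegular.inv_mul_pow_eq_one (hP : IsWeaklyRegular n P) (a b : P) :
    a ^ n = b ^ n → (a⁻¹ * b) ^ n = 1 := by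
  induction a, b using pairwise_of_commute_of_normalizer with
  | hcomm a b hab =>
    intro h
    rw [hab.inv_left.mul_pow, inv_pow, h, inv_mul_cancel]
  | hstep a b M hbM haM ih =>
    intro h
    have hcb : a⁻¹ * b * a ∈ M := (Subgroup.mem_normalizer_iff''.1 haM b).1 hbM
    have hcbn : (a⁻¹ * b * a) ^ n = b ^ n := by
      have hconj : (a⁻¹ * b * a⁻¹⁻¹) ^ n = a⁻¹ * b ^ n * a⁻¹⁻¹ := conj_pow
      rw [inv_inv] at hconj
      rw [hconj, ← h, mul_assoc, ← pow_succ, pow_succ', inv_mul_cancel_left]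
    have hcomm : ⁅a⁻¹, b⁆ ^ n = 1 := by
      rw [commutatorElement_def]
      simpa only [inv_inv] using
        ih _ (M.inv_mem hcb) _ (M.inv_mem hbM) (by rw [inv_pow, inv_pow, hcbn])
    rw [hP.mul_pow_of_commutator_mem (M := ⊤)
      (fun x _ y _ hxn hyn => (hP.mul_pow_of_pow_eq_one x y hyn).trans hxn)
      (Subgroup.le_normalizer (Subgroup.mem_top _)) (Subgroup.le_normalizer (Subgroup.mem_top _))
      (Subgroup.mem_top _) hcomm, inv_pow, h, inv_mul_cancel]

theorem IsWeaklyRegular.hasTorsionPowFibers (hP : IsWeaklyRegular n P) :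
    HasTorsionPowFibers n P := by
  refine fun a b => ⟨hP.inv_mul_pow_eq_one a b, fun h => ?_⟩
  rw [← hP.mul_pow_of_pow_eq_one a _ h, mul_inv_cancel_left]

end PowerFibres

section Closure

variable {n : ℕ}

theorem HasTorsionPowFibers.of_injective {P Q : Type*} [Group P] [Group Q]
    (h : HasTorsionPowFibers n Q) {f : P →* Q} (hf : Function.Injective f) :
    HasTorsionPowFibers n P := by
  intro a b
  rw [← hf.eq_iff, map_pow, map_pow, h, ← hf.eq_iff, map_pow, map_mul, map_inv, map_one]

theorem HasTorsionPowFibers.pi {ι : Type*} {P : ι → Type*} [∀ i, Group (P i)]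
    (h : ∀ i, HasTorsionPowFibers n (P i)) : HasTorsionPowFibers n (∀ i, P i) := by
  intro a b
  rw [funext_iff, funext_iff]
  exact forall_congr' fun i => h i (a i) (b i)

theorem HasTorsionPowFibers.mul_of_injective_pow {P : Type*} [Group P] {k : ℕ}
    (h : HasTorsionPowFibers n P) (hk : Function.Injective fun x : P => x ^ k) :
    HasTorsionPowFibers (n * k) P := by
  have hpow (x y : P) : x ^ (n * k) = y ^ (n * k) ↔ x ^ n = y ^ n := by
    rw [pow_mul, pow_mul]
    exact hk.eq_iff
  have hpow_one (x : P) : x ^ (n * k) = 1 ↔ x ^ n = 1 := by simpa only [one_pow] using hpow x 1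
  exact fun a b => by rw [hpow, h, hpow_one]

theorem IsRegularPGroup.hasTorsionPowFibers {p : ℕ} {P : Type u} [Group P] [Finite P]
    (h : IsRegularPGroup p P) (hn : n ≠ 0) : HasTorsionPowFibers n P := by
  have : Fact p.Prime := ⟨h.1⟩
  have : Group.IsNilpotent P := h.2.1.isNilpotent
  obtain ⟨α, k, hk, rfl⟩ := Nat.exists_eq_pow_mul_and_not_dvd hn p h.1.ne_one
  have hcop : p.Coprime k := (Nat.Prime.coprime_iff_not_dvd h.1).2 hk
  exact (h.isWeaklyRegular α).hasTorsionPowFibers.mul_of_injective_pow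
    (h.2.1.powEquiv hcop).injective

theorem IsProdOfRegularPGroups.hasTorsionPowFibers {C : Type u} [Group C] [Finite C]
    (h : IsProdOfRegularPGroups C) (hn : n ≠ 0) : HasTorsionPowFibers n C := by
  obtain ⟨k, p, P, _, hP, ⟨e⟩⟩ := h
  refine .of_injective (.pi fun i => ?_) (f := e.toMonoidHom) e.injective
  have : Finite (P i) :=
    Finite.of_surjective (fun c => e c i) ((Function.surjective_eval i).comp e.surjective)
  exact (hP i).hasTorsionPowFibers hn

theorem IsRegularNilpotent.hasTorsionPowFibers {C : Type u} [Group C] [Finite C]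
    (h : IsRegularNilpotent C) (hn : n ≠ 0) : HasTorsionPowFibers n C := by
  obtain ⟨e⟩ := (Group.isNilpotent_of_finite_tfae.out 0 4).1 h.1
  refine .of_injective (.pi fun p => .pi fun P => ?_) (f := e.symm.toMonoidHom) e.symm.injective
  exact (h.2 p (Nat.prime_of_mem_primeFactors p.2) P).hasTorsionPowFibers hn

end Closure

section RootCounts

variable {G : Type*} [Group G] {n : ℕ}

/-- The number of `y` such that both `y` and `y u` are `n`-th roots of `g`. -/
noncomputable def commonRootCount (n : ℕ) (u g : G) : ℕ :=
  Nat.card {y : G // y ^ n = g ∧ (y * u) ^ n = g}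

open Classical in
theorem HasTorsionPowFibers.commonRootCount_eq_ite (hG : HasTorsionPowFibers n G) (u g : G) :
    commonRootCount n u g =
      if u ^ n = 1 ∧ ∃ y : G, y ^ n = g then Nat.card {t : G // t ^ n = 1} else 0 := by
  have hroot (y : G) : y ^ n = (y * u) ^ n ↔ u ^ n = 1 := by rw [hG, inv_mul_cancel_left]
  split_ifs with h
  · obtain ⟨hu, y₀, rfl⟩ := h
    refine Nat.card_congr ((Equiv.mulLeft y₀⁻¹).subtypeEquiv fun y => ?_)
    rw [← (hroot y).2 hu, and_self, eq_comm, hG, Equiv.coe_mulLeft]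
  · refine Nat.card_eq_zero.2 (.inl ⟨fun ⟨y, hy, hyu⟩ => h ⟨?_, y, hy⟩⟩)
    exact (hroot y).1 (hy.trans hyu.symm)

theorem exists_pow_eq_of_mem_zpowers {g g' : G} (hg : g' ∈ Subgroup.zpowers g) :
    (∃ y, y ^ n = g) → ∃ y, y ^ n = g' := by
  rintro ⟨y, rfl⟩
  obtain ⟨m, rfl⟩ := Subgroup.mem_zpowers_iff.1 hg
  exact ⟨y ^ m, by rw [← zpow_natCast, ← zpow_natCast, zpow_comm]⟩

theorem HasTorsionPowFibers.commonRootCount_eq_of_zpowers_eq (hG : HasTorsionPowFibers n G) (u : G)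
    {g g' : G} (hg : Subgroup.zpowers g = Subgroup.zpowers g') :
    commonRootCount n u g = commonRootCount n u g' := by
  classical
  have hiff : (∃ y, y ^ n = g) ↔ ∃ y, y ^ n = g' :=
    ⟨exists_pow_eq_of_mem_zpowers (hg ▸ Subgroup.mem_zpowers g'),
      exists_pow_eq_of_mem_zpowers (hg ▸ Subgroup.mem_zpowers g)⟩
  simp only [hG.commonRootCount_eq_ite, hiff]

theorem commonRootCount_subgroup {K : Subgroup G} (u g : K)
    (hK : Subgroup.centralizer {(g : G)} ≤ K) :
    commonRootCount n u g = commonRootCount n (u : G) (g : G) := by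
  have hroot (y : G) (hy : y ^ n = g ∧ (y * u) ^ n = g) : y ∈ K :=
    hK (Subgroup.mem_centralizer_singleton_iff.2 (by rw [← hy.1, ← pow_succ, ← pow_succ']))
  refine Nat.card_congr (.trans (Equiv.subtypeEquivRight fun y => ?_)
    (Equiv.subtypeSubtypeEquivSubtype (p := (· ∈ K)) (hroot _)))
  simp only [Subtype.ext_iff, Subgroup.coe_pow, Subgroup.coe_mul]

theorem mem_centralizer_of_commonRootCount_ne_zero {u g : G} (h : commonRootCount n u g ≠ 0) :
    u ∈ Subgroup.centralizer {g} := by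
  obtain ⟨⟨y, hy, hyu⟩⟩ := (Nat.card_ne_zero.1 h).1
  have hcomm_y : Commute y g := hy ▸ Commute.self_pow y n
  have hcomm_yu : Commute (y * u) g := hyu ▸ Commute.self_pow (y * u) n
  rw [Subgroup.mem_centralizer_singleton_iff]
  simpa only [inv_mul_cancel_left] using (hcomm_y.inv_left.mul_left hcomm_yu).eq

theorem centralizer_singleton_eq_of_zpowers_eq {g g' : G}
    (hg : Subgroup.zpowers g = Subgroup.zpowers g') :
    Subgroup.centralizer {g} = Subgroup.centralizer {g'} := by
  rw [← Subgroup.centralizer_closure {g}, ← Subgroup.centralizer_closure {g'},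
    ← Subgroup.zpowers_eq_closure, ← Subgroup.zpowers_eq_closure, hg]

theorem commonRootCount_eq_of_centralizer_hasTorsionPowFibers {g g' : G}
    (hC : HasTorsionPowFibers n (Subgroup.centralizer {g})) (u : G)
    (hg : Subgroup.zpowers g = Subgroup.zpowers g') :
    commonRootCount n u g = commonRootCount n u g' := by
  have hcent := centralizer_singleton_eq_of_zpowers_eq hg
  by_cases hu : u ∈ Subgroup.centralizer {g}
  · have hgm : g ∈ Subgroup.centralizer {g} := Subgroup.mem_centralizer_singleton_iff.2 rfl
    have hgm' : g' ∈ Subgroup.centralizer {g} :=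
      hcent ▸ Subgroup.mem_centralizer_singleton_iff.2 rfl
    have hzpowers : Subgroup.zpowers (⟨g, hgm⟩ : Subgroup.centralizer {g}) =
        Subgroup.zpowers ⟨g', hgm'⟩ := by
      apply Subgroup.map_injective (Subgroup.centralizer {g}).subtype_injective
      rw [MonoidHom.map_zpowers, MonoidHom.map_zpowers]
      exact hg
    have hcount := hC.commonRootCount_eq_of_zpowers_eq ⟨u, hu⟩ hzpowers
    rwa [commonRootCount_subgroup _ _ le_rfl, commonRootCount_subgroup _ _ hcent.ge] at hcount
  · rw [of_not_not (mt mem_centralizer_of_commonRootCount_ne_zero hu),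
      of_not_not (mt mem_centralizer_of_commonRootCount_ne_zero (hcent ▸ hu))]

end RootCounts

section SumOverGenerators

variable {G A : Type*} [Group G] [Fintype G] [AddCommGroup A] {S : AddSubgroup A} {f : G → A}

open Classical in
theorem sum_subgroup_eq_sum_sum_generators (K : Subgroup G) :
    ∑ h : K, f h = ∑ L : Subgroup G with L ≤ K, ∑ g with Subgroup.zpowers g = L, f g := by
  rw [← Finset.sum_subtype {g | g ∈ K} (by simp) f,
    ← Finset.sum_fiberwise_of_maps_to (g := Subgroup.zpowers) (t := {L | L ≤ K}) (by simp)]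
  refine Finset.sum_congr rfl fun L hL => Finset.sum_congr ?_ fun _ _ => rfl
  ext g
  simp only [Finset.mem_filter, Finset.mem_univ, true_and] at hL ⊢
  exact and_iff_right_of_imp fun hg => hL (hg ▸ Subgroup.mem_zpowers g)

open Classical in
theorem sum_generators_mem (K : Subgroup G) (hf : ∀ L ≤ K, ∑ h : L, f h ∈ S) :
    ∑ g with Subgroup.zpowers g = K, f g ∈ S := by
  induction K using WellFoundedLT.induction with
  | _ K ih =>
  have hK := hf K le_rfl
  rw [sum_subgroup_eq_sum_sum_generators, ← Finset.add_sum_erase _ _ (a := K) (by simp)] at hK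
  refine (S.add_mem_cancel_right (S.sum_mem fun L hL => ?_)).1 hK
  simp only [Finset.mem_erase, Finset.mem_filter, Finset.mem_univ, true_and] at hL
  exact ih L (hL.2.lt_of_ne hL.1) fun L' hL' => hf L' (hL'.trans hL.2)

open Classical in
theorem sum_smul_mem_of_eq_on_generators {w : G → ℕ}
    (hw : ∀ g g', Subgroup.zpowers g = Subgroup.zpowers g' → w g = w g')
    (hf : ∀ g, w g ≠ 0 → ∀ K ≤ Subgroup.zpowers g, ∑ h : K, f h ∈ S) :
    ∑ g, w g • f g ∈ S := by
  rw [← Finset.sum_fiberwise (s := Finset.univ) (g := fun g : G => Subgroup.zpowers g)]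
  refine S.sum_mem fun K _ => ?_
  by_cases hK : ∃ g, Subgroup.zpowers g = K ∧ w g ≠ 0
  · obtain ⟨g, rfl, hg⟩ := hK
    have hsum : ∑ x with Subgroup.zpowers x = Subgroup.zpowers g, w x • f x =
        w g • ∑ x with Subgroup.zpowers x = Subgroup.zpowers g, f x := by
      rw [Finset.smul_sum]
      exact Finset.sum_congr rfl fun x hx => by rw [hw x g (Finset.mem_filter.1 hx).2]
    rw [hsum]
    exact S.nsmul_mem (sum_generators_mem _ (hf g hg)) _
  · push Not at hK
    rw [Finset.sum_eq_zero fun x hx => by rw [hK x (Finset.mem_filter.1 hx).2, zero_smul]]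
    exact S.zero_mem

end SumOverGenerators

section Integrality

theorem isIdempotentElem_average {k A K : Type*} [Field k] [Ring A] [Algebra k A] [Group K]
    [Fintype K] (hcard : (Fintype.card K : k) ≠ 0) {φ : K → A}
    (hφ : ∀ x y, φ x * φ y = φ (x * y)) :
    IsIdempotentElem ((Fintype.card K : k)⁻¹ • ∑ x, φ x) := by
  have hright (y : K) : ∑ x, φ (x * y) = ∑ x, φ x := Equiv.sum_comp (Equiv.mulRight y) φ
  have hsq : (∑ x, φ x) * ∑ x, φ x = (Fintype.card K : k) • ∑ x, φ x := by
    simp only [Finset.sum_mul, Finset.mul_sum, hφ, hright, Finset.sum_const, Finset.card_univ,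
      Nat.cast_smul_eq_nsmul]
  rw [IsIdempotentElem, smul_mul_smul_comm, hsq, smul_smul, mul_assoc, inv_mul_cancel₀ hcard,
    mul_one]

theorem isIntegral_of_isIdempotentElem (R : Type*) {B : Type*} [CommRing R] [Ring B] [Algebra R B]
    {e : B} (he : IsIdempotentElem e) : IsIntegral R e := by
  refine ⟨Polynomial.X ^ 2 - Polynomial.X, ?_, ?_⟩
  · exact Polynomial.monic_X_pow_sub (Polynomial.degree_X_le.trans_lt (by norm_num))
  · simp [sq, he.eq]

theorem isIntegral_mul_of_isIdempotentElem_of_isOfFinOrder (R : Type*) {B : Type*} [CommRing R]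
    [Ring B] [Algebra R B] {e s : B} (he : IsIdempotentElem e) (hs : IsOfFinOrder s)
    (hes : Commute e s) : IsIntegral R (e * s) := by
  refine IsIntegral.of_pow hs.orderOf_pos ?_
  rw [hes.mul_pow, pow_orderOf_eq_one, mul_one, he.pow_eq hs.orderOf_pos.ne']
  exact isIntegral_of_isIdempotentElem R he

theorem isIntegral_of_mem_spectrum {R K A : Type*} [CommRing R] [Field K] [Algebra R K] [Ring A]
    [Algebra K A] [Algebra R A] [IsScalarTower R K A] {a : A} (ha : IsIntegral R a) {r : K}
    (hr : r ∈ spectrum K a) : IsIntegral R r := by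
  obtain ⟨p, hp, hpa⟩ := ha
  have : Nontrivial A := by
    by_contra h
    rw [not_nontrivial_iff_subsingleton] at h
    simp [spectrum.of_subsingleton] at hr
  have hmem := spectrum.subset_polynomial_aeval a (p.map (algebraMap R K)) ⟨r, hr, rfl⟩
  rw [Polynomial.aeval_map_algebraMap, Polynomial.aeval_def, hpa, spectrum.zero_eq] at hmem
  exact ⟨p, hp, by simpa only [Polynomial.eval_map, Set.mem_singleton_iff] using hmem⟩

theorem isIntegral_trace_of_isIntegral {R K J : Type*} [CommRing R] [Field K] [IsAlgClosed K]
    [Algebra R K] [Fintype J] [DecidableEq J] {M : Matrix J J K} (hM : IsIntegral R M) :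
    IsIntegral R M.trace := by
  rw [Matrix.trace_eq_sum_roots_charpoly]
  refine IsIntegral.multiset_sum fun r hr => isIntegral_of_mem_spectrum hM ?_
  exact Matrix.mem_spectrum_iff_isRoot_charpoly.2 (Polynomial.isRoot_of_mem_roots hr)

theorem exists_int_eq_of_isIntegral {K : Type*} [Field K] [CharZero K] {z : K}
    (hz : IsIntegral ℤ z) {N : ℕ} (hN : N ≠ 0) (hNz : ∃ c : ℤ, N * z = c) : ∃ k : ℤ, z = k := by
  obtain ⟨c, hc⟩ := hNz
  have hrat : z = algebraMap ℚ K (c / N) := by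
    rw [map_div₀, map_natCast, map_intCast, eq_div_iff (Nat.cast_ne_zero.2 hN), mul_comm, hc]
  rw [hrat, isIntegral_algebraMap_iff (algebraMap ℚ K).injective,
    IsIntegrallyClosed.isIntegral_iff] at hz
  obtain ⟨k, hk⟩ := hz
  exact ⟨k, by rw [hrat, ← hk]; simp⟩

end Integrality

section Character

variable {H : Type u} [Ring H] [HopfAlgebra ℂ H]
  (V : Type v) [AddCommGroup V] [Module ℂ V] [Module H V] [IsScalarTower ℂ H V] [Module.Finite ℂ V]

theorem moduleCharacter_eq_finrank_of_isIdempotentElem {e : H} (he : IsIdempotentElem e) :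
    moduleCharacter V e = Module.finrank ℂ (LinearMap.range (Algebra.lsmul ℂ ℂ V e)) :=
  (LinearMap.IsIdempotentElem.isProj_range _ (he.map (Algebra.lsmul ℂ ℂ V))).trace

theorem sum_moduleCharacter_mem_range_intCast {K : Type*} [Group K] [Fintype K] {φ : K → H}
    (hφ : ∀ x y, φ x * φ y = φ (x * y)) :
    ∑ x, moduleCharacter V (φ x) ∈ (Int.castAddHom ℂ).range := by
  have hcard : (Fintype.card K : ℂ) ≠ 0 := Nat.cast_ne_zero.2 Fintype.card_ne_zero
  have htrace :=
    moduleCharacter_eq_finrank_of_isIdempotentElem V (isIdempotentElem_average hcard hφ)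
  have hsum : moduleCharacter V ((Fintype.card K : ℂ)⁻¹ • ∑ x, φ x) =
      (Fintype.card K : ℂ)⁻¹ * ∑ x, moduleCharacter V (φ x) := by
    simp only [moduleCharacter, map_smul, map_sum, smul_eq_mul]
  rw [hsum, inv_mul_eq_iff_eq_mul₀ hcard] at htrace
  rw [htrace, ← Nat.cast_mul]
  exact ⟨_, Int.cast_natCast _⟩

end Character

section TensorPower

variable {R I κ : Type*} [CommSemiring R]

/-- The tensor product of the matrices `A k`, acting on functions `κ → I`: a pure tensor of basis
vectors is encoded by the function listing their indices. -/
def tensorMatrix [Fintype κ] (A : κ → Matrix I I R) : Matrix (κ → I) (κ → I) R :=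
  Matrix.of fun i j => ∏ k, A k (i k) (j k)

theorem tensorMatrix_mul [Fintype κ] [DecidableEq κ] [Fintype I] (A B : κ → Matrix I I R) :
    tensorMatrix A * tensorMatrix B = tensorMatrix fun k => A k * B k := by
  ext i j
  simp only [tensorMatrix, Matrix.mul_apply, Matrix.of_apply, ← Finset.prod_mul_distrib]
  rw [Finset.prod_univ_sum, Fintype.piFinset_univ]

theorem tensorMatrix_eq_zero [Fintype κ] {A : κ → Matrix I I R} {k : κ} (h : A k = 0) :
    tensorMatrix A = 0 := by
  ext i j
  exact Finset.prod_eq_zero (Finset.mem_univ k) (by rw [h]; rfl)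

variable [Fintype κ] [DecidableEq κ] [Fintype I] [DecidableEq I]

variable (R I) in
/-- The permutation `σ` of the tensor factors, as a matrix on functions `κ → I`: it sends the basis
vector indexed by `j` to the one indexed by `j ∘ σ`. -/
def permuteFactors (σ : Equiv.Perm κ) : Matrix (κ → I) (κ → I) R :=
  Equiv.Perm.permMatrix R (σ.arrowCongr (Equiv.refl I))

theorem mul_permuteFactors_apply (M : Matrix (κ → I) (κ → I) R) (σ : Equiv.Perm κ) (i j : κ → I) :
    (M * permuteFactors R I σ) i j = M i (j ∘ σ) := by
  rw [permuteFactors, Equiv.Perm.permMatrix, PEquiv.mul_toMatrix_toPEquiv]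
  rfl

theorem permuteFactors_mul_apply (M : Matrix (κ → I) (κ → I) R) (σ : Equiv.Perm κ) (i j : κ → I) :
    (permuteFactors R I σ * M) i j = M (i ∘ σ.symm) j := by
  rw [permuteFactors, Equiv.Perm.permMatrix, PEquiv.toMatrix_toPEquiv_mul]
  rfl

theorem tensorMatrix_comp_mul_permuteFactors (A : κ → Matrix I I R) (σ : Equiv.Perm κ) :
    tensorMatrix (A ∘ σ) * permuteFactors R I σ = permuteFactors R I σ * tensorMatrix A := by
  ext i j
  rw [mul_permuteFactors_apply, permuteFactors_mul_apply]
  simp only [tensorMatrix, Matrix.of_apply]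
  rw [← Equiv.prod_comp σ fun k => A k ((i ∘ σ.symm) k) (j k)]
  simp only [Function.comp_apply, Equiv.symm_apply_apply]

variable (R I) in
theorem isOfFinOrder_permuteFactors (σ : Equiv.Perm κ) : IsOfFinOrder (permuteFactors R I σ) := by
  have h := (Matrix.permMatrixHom (n := κ → I) (R := R)).isOfFinOrder
    (isOfFinOrder_of_finite (σ.arrowCongr (Equiv.refl I) : Equiv.Perm (κ → I))⁻¹)
  rwa [Matrix.permMatrixHom_apply, inv_inv] at h

theorem list_prod_ofFn_apply (n : ℕ) (A : Fin (n + 1) → Matrix I I R) (i j : I) :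
    (List.ofFn A).prod i j = ∑ p : Fin n → I, ∏ k,
      A k (Fin.cons (α := fun _ => I) i p k) (Fin.snoc (α := fun _ => I) p j k) := by
  induction n generalizing i with
  | zero => simp [Fin.snoc]
  | succ n ih =>
    rw [List.ofFn_succ, List.prod_cons, Matrix.mul_apply,
      ← (Fin.consEquiv (n := n) (fun _ => I)).sum_comp, Fintype.sum_prod_type]
    refine Finset.sum_congr rfl fun l _ => ?_
    rw [ih, Finset.mul_sum]
    refine Finset.sum_congr rfl fun q _ => ?_
    have hcons : (Fin.consEquiv fun _ => I) (l, q) = Fin.cons (α := fun _ => I) l q := rfl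
    rw [hcons, Fin.prod_univ_succ (n := n + 1), ← Fin.cons_snoc_eq_snoc_cons]
    simp only [Fin.cons_zero, Fin.cons_succ]

theorem trace_tensorMatrix_mul_permuteFactors_finRotate {n : ℕ} (hn : n ≠ 0)
    (A : Fin n → Matrix I I R) :
    (tensorMatrix A * permuteFactors R I (finRotate n)).trace = (List.ofFn A).prod.trace := by
  obtain ⟨n, rfl⟩ := Nat.exists_eq_succ_of_ne_zero hn
  simp only [Matrix.trace, Matrix.diag_apply, mul_permuteFactors_apply, list_prod_ofFn_apply]
  rw [← (Fin.consEquiv (n := n) (fun _ => I)).sum_comp, Fintype.sum_prod_type]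
  refine Finset.sum_congr rfl fun i _ => Finset.sum_congr rfl fun p _ => ?_
  simp only [Fin.snoc_eq_cons_rotate, tensorMatrix, Matrix.of_apply, Fin.consEquiv_apply,
    Function.comp_apply]

end TensorPower

section ListProd

variable {G : Type*} [Group G] {n : ℕ}

theorem list_prod_ofFn_comp_finRotate_eq_one_iff (a : Fin n → G) :
    (List.ofFn (a ∘ finRotate n)).prod = 1 ↔ (List.ofFn a).prod = 1 := by
  cases n with
  | zero => simp
  | succ n =>
    have hrotate : a ∘ finRotate (n + 1) = Fin.snoc (α := fun _ => G) (Fin.tail a) (a 0) := by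
      rw [Fin.snoc_eq_cons_rotate]
      funext i
      exact (congrFun (Fin.cons_self_tail a) _).symm
    rw [hrotate, List.ofFn_succ', List.ofFn_succ]
    simp only [Fin.snoc_castSucc, Fin.snoc_last, List.concat_eq_append, List.prod_append,
      List.prod_cons, List.prod_nil, mul_one]
    rw [mul_eq_one_iff_eq_inv, mul_eq_one_iff_inv_eq, eq_comm]
    rfl

theorem list_prod_ofFn_conj (x : G) (a : Fin n → G) :
    (List.ofFn fun k => x⁻¹ * a k * x).prod = x⁻¹ * (List.ofFn a).prod * x := by
  have h := map_list_prod (MulAut.conj x⁻¹) (List.ofFn a)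
  simpa [List.map_ofFn, Function.comp_def] using h.symm

end ListProd

namespace DrinfeldDouble

variable {G : Type u} [Group G] [Fintype G]

theorem basisElt_mul_basisElt_of_commute {a x : G} (h : Commute a x) (y : G) :
    basisElt a x * basisElt a y = basisElt a (x * y) := by
  rw [basisElt_mul_basisElt, if_pos (eq_mul_inv_of_mul_eq h.eq)]

instance : Module.Finite ℂ (DrinfeldDouble G) :=
  Module.Finite.equiv (M := G → G → ℂ)
    { coeffEquiv.symm with
      map_add' := fun _ _ => rfl
      map_smul' := fun _ _ => rfl }

section SweedlerPower

theorem sweedlerPow_succ_basisElt (n : ℕ) (g x : G) :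
    sweedlerPow (DrinfeldDouble G) (n + 1) (basisElt g x) =
      ∑ a, sweedlerPow (DrinfeldDouble G) n (basisElt a x) * basisElt (a⁻¹ * g) x := by
  simp only [sweedlerPow, LinearMap.comp_apply, comul_basisElt, map_sum, LinearMap.rTensor_tmul,
    LinearMap.mul'_apply]

open Classical in
theorem sweedlerPow_basisElt_eq_sum_list (n : ℕ) (g x : G) :
    sweedlerPow (DrinfeldDouble G) n (basisElt g x) =
      ∑ a : Fin n → G with (List.ofFn a).prod = g,
        (List.ofFn fun k => basisElt (a k) x).prod := by
  induction n generalizing g with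
  | zero =>
    by_cases hg : g = 1
    · simp [sweedlerPow, counit_basisElt, hg]
    · simp [sweedlerPow, counit_basisElt, hg, Ne.symm hg]
  | succ n ih =>
    simp only [sweedlerPow_succ_basisElt, ih, Finset.sum_mul, Finset.sum_filter, ite_mul, zero_mul]
    rw [Finset.sum_comm, ← (Fin.snocEquiv (n := n) (fun _ => G)).sum_comp,
      Fintype.sum_prod_type_right]
    refine Finset.sum_congr rfl fun a _ => ?_
    have hprod (b : G) :
        (List.ofFn (Fin.snocEquiv (fun _ => G) (b, a))).prod = (List.ofFn a).prod * b := by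
      simp [List.ofFn_succ', Fin.snocEquiv, -List.ofFn_succ]
    simp only [hprod, ← eq_inv_mul_iff_mul_eq, Finset.sum_ite_eq, Finset.sum_ite_eq',
      Finset.mem_univ, if_true]
    simp [List.ofFn_succ', Fin.snocEquiv, -List.ofFn_succ]

open Classical in
theorem sweedlerPow_basisElt (n : ℕ) (g x : G) :
    sweedlerPow (DrinfeldDouble G) n (basisElt g x) =
      ∑ a, if (a * x⁻¹) ^ n * x ^ n = g then basisElt a (x ^ n) else 0 := by
  induction n generalizing g with
  | zero =>
    by_cases hg : g = 1
    · simp [sweedlerPow, counit_basisElt, hg, one_eq_sum]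
    · simp [sweedlerPow, counit_basisElt, hg, Ne.symm hg]
  | succ n ih =>
    simp only [sweedlerPow_succ_basisElt, ih, Finset.sum_mul, ite_mul, zero_mul,
      basisElt_mul_basisElt]
    rw [Finset.sum_comm]
    refine Finset.sum_congr rfl fun a _ => ?_
    rw [Finset.sum_ite_eq, if_pos (Finset.mem_univ _), ← pow_succ]
    refine if_congr ?_ rfl rfl
    rw [eq_mul_inv_iff_mul_eq, ← inv_mul_eq_iff_eq_mul, eq_inv_mul_iff_mul_eq,
      pow_succ (a * x⁻¹), pow_succ' x]
    simp only [mul_assoc, inv_mul_cancel_left, mul_inv_cancel_left]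

end SweedlerPower

section Indicator

variable (V : Type v) [AddCommGroup V] [Module ℂ V] [Module (DrinfeldDouble G) V]
  [IsScalarTower ℂ (DrinfeldDouble G) V]

theorem sum_moduleCharacter_basisElt_mem_range_intCast [Module.Finite ℂ V] {a : G} {K : Subgroup G}
    [Fintype K] (hK : K ≤ Subgroup.centralizer {a}) :
    ∑ h : K, moduleCharacter V (basisElt a (h : G)) ∈ (Int.castAddHom ℂ).range :=
  sum_moduleCharacter_mem_range_intCast V fun x y => basisElt_mul_basisElt_of_commute
    (Subgroup.mem_centralizer_singleton_iff.1 (hK x.2)).symm (y : G)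

open Classical in
theorem card_mul_frobeniusSchurIndicator_eq_sum_ite (n : ℕ) :
    (Fintype.card G : ℂ) * frobeniusSchurIndicator (integral G) n V =
      ∑ a : G, ∑ y : G,
        if (y * a) ^ n = y ^ n then moduleCharacter V (basisElt a (y ^ n)) else 0 := by
  have hcard : (Fintype.card G : ℂ) ≠ 0 := Nat.cast_ne_zero.2 Fintype.card_ne_zero
  simp only [frobeniusSchurIndicator, integral, moduleCharacter, map_smul, map_sum, smul_eq_mul,
    mul_inv_cancel_left₀ hcard, sweedlerPow_basisElt]
  rw [Finset.sum_comm]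
  refine Finset.sum_congr rfl fun a _ => ?_
  rw [← Equiv.sum_comp (Equiv.mulRight a)]
  refine Finset.sum_congr rfl fun y _ => ?_
  have hiff : (a * (y * a)⁻¹) ^ n * (y * a) ^ n = 1 ↔ (y * a) ^ n = y ^ n := by
    rw [mul_inv_rev, mul_inv_cancel_left, inv_pow, inv_mul_eq_one, eq_comm]
  rw [Equiv.coe_mulRight, if_congr hiff rfl rfl]
  split_ifs with h
  · rw [h]
  · rw [map_zero, map_zero]

theorem card_mul_frobeniusSchurIndicator (n : ℕ) :
    (Fintype.card G : ℂ) * frobeniusSchurIndicator (integral G) n V =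
      ∑ a : G, ∑ g : G, commonRootCount n a g • moduleCharacter V (basisElt a g) := by
  classical
  rw [card_mul_frobeniusSchurIndicator_eq_sum_ite]
  refine Finset.sum_congr rfl fun a _ => ?_
  rw [← Finset.sum_fiberwise (s := Finset.univ) (g := fun y : G => y ^ n)]
  refine Finset.sum_congr rfl fun g _ => ?_
  rw [commonRootCount, Nat.card_eq_fintype_card, Fintype.card_subtype, ← Finset.filter_filter,
    ← Finset.sum_const, Finset.sum_filter fun y => (y * a) ^ n = g]
  exact Finset.sum_congr rfl fun y hy => by rw [(Finset.mem_filter.1 hy).2]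

theorem card_mul_frobeniusSchurIndicator_mem_range_intCast [Module.Finite ℂ V] {n : ℕ}
    (hG : ∀ u g g' : G, Subgroup.zpowers g = Subgroup.zpowers g' →
      commonRootCount n u g = commonRootCount n u g') :
    (Fintype.card G : ℂ) * frobeniusSchurIndicator (integral G) n V ∈
      (Int.castAddHom ℂ).range := by
  classical
  rw [card_mul_frobeniusSchurIndicator]
  refine AddSubgroup.sum_mem _ fun a _ => sum_smul_mem_of_eq_on_generators (hG a) ?_
  intro g hg K hK
  have ha : a ∈ Subgroup.centralizer {g} := mem_centralizer_of_commonRootCount_ne_zero hg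
  refine sum_moduleCharacter_basisElt_mem_range_intCast V (hK.trans (Subgroup.zpowers_le.2 ?_))
  rw [Subgroup.mem_centralizer_singleton_iff] at ha ⊢
  exact ha.symm

end Indicator

section TensorPower

variable {I : Type*} [Fintype I] [DecidableEq I] (ρ : DrinfeldDouble G →ₐ[ℂ] Matrix I I ℂ) (n : ℕ)

open Classical in
/-- The action of `e₁ # x` on the `n`-th tensor power of the representation `ρ`. -/
noncomputable def tensorAction (x : G) : Matrix (Fin n → I) (Fin n → I) ℂ :=
  ∑ a : Fin n → G with (List.ofFn a).prod = 1, tensorMatrix fun k => ρ (basisElt (a k) x)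

theorem tensorAction_mul (x y : G) :
    tensorAction ρ n x * tensorAction ρ n y = tensorAction ρ n (x * y) := by
  classical
  simp only [tensorAction, Finset.sum_mul_sum, tensorMatrix_mul, ← map_mul, basisElt_mul_basisElt]
  refine Finset.sum_congr rfl fun a ha => ?_
  rw [Finset.sum_eq_single fun k => x⁻¹ * a k * x]
  · refine congrArg tensorMatrix (funext fun k => ?_)
    rw [if_pos (by group)]
  · intro b _ hb
    obtain ⟨k, hk⟩ := Function.ne_iff.1 hb
    refine tensorMatrix_eq_zero (k := k) ?_
    rw [if_neg fun h => hk (by rw [h]; group), map_zero]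
  · intro h
    refine absurd (Finset.mem_filter.2 ⟨Finset.mem_univ _, ?_⟩) h
    rw [list_prod_ofFn_conj, (Finset.mem_filter.1 ha).2, mul_one, inv_mul_cancel]

theorem commute_tensorAction_permuteFactors_finRotate (x : G) :
    Commute (tensorAction ρ n x) (permuteFactors ℂ I (finRotate n)) := by
  classical
  rw [Commute, SemiconjBy, tensorAction, Finset.sum_mul, Finset.mul_sum, Finset.sum_filter,
    Finset.sum_filter, ← ((finRotate n).symm.arrowCongr (Equiv.refl G)).sum_comp]
  refine Finset.sum_congr rfl fun a _ => ?_
  exact if_congr (list_prod_ofFn_comp_finRotate_eq_one_iff a)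
    (tensorMatrix_comp_mul_permuteFactors (fun k => ρ (basisElt (a k) x)) (finRotate n)) rfl

/-- The action of the normalized integral on the `n`-th tensor power of the representation `ρ`. -/
noncomputable def tensorIntegral : Matrix (Fin n → I) (Fin n → I) ℂ :=
  (Fintype.card G : ℂ)⁻¹ • ∑ x, tensorAction ρ n x

theorem isIdempotentElem_tensorIntegral : IsIdempotentElem (tensorIntegral ρ n) :=
  isIdempotentElem_average (Nat.cast_ne_zero.2 Fintype.card_ne_zero) (tensorAction_mul ρ n)

theorem commute_tensorIntegral_permuteFactors_finRotate :
    Commute (tensorIntegral ρ n) (permuteFactors ℂ I (finRotate n)) :=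
  (Commute.sum_left _ _ _ fun x _ =>
    commute_tensorAction_permuteFactors_finRotate ρ n x).smul_left _

variable {n}

theorem trace_tensorIntegral_mul_permuteFactors_finRotate (hn : n ≠ 0) :
    (tensorIntegral ρ n * permuteFactors ℂ I (finRotate n)).trace =
      (ρ (sweedlerPow (DrinfeldDouble G) n (integral G))).trace := by
  classical
  simp only [tensorIntegral, integral, map_smul, map_sum, sweedlerPow_basisElt_eq_sum_list,
    tensorAction, smul_mul_assoc, Finset.sum_mul, Matrix.trace_smul, Matrix.trace_sum,
    trace_tensorMatrix_mul_permuteFactors_finRotate hn, map_list_prod, List.map_ofFn,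
    Function.comp_def]

theorem isIntegral_trace_sweedlerPow_integral (hn : n ≠ 0) :
    IsIntegral ℤ (ρ (sweedlerPow (DrinfeldDouble G) n (integral G))).trace := by
  rw [← trace_tensorIntegral_mul_permuteFactors_finRotate ρ hn]
  exact isIntegral_trace_of_isIntegral (isIntegral_mul_of_isIdempotentElem_of_isOfFinOrder ℤ
    (isIdempotentElem_tensorIntegral ρ n) (isOfFinOrder_permuteFactors ℂ I (finRotate n))
    (commute_tensorIntegral_permuteFactors_finRotate ρ n))

end TensorPower

section FSZ

theorem isIntegral_frobeniusSchurIndicator (V : Type v) [AddCommGroup V] [Module ℂ V]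
    [Module (DrinfeldDouble G) V] [IsScalarTower ℂ (DrinfeldDouble G) V] [Module.Finite ℂ V]
    {n : ℕ} (hn : n ≠ 0) : IsIntegral ℤ (frobeniusSchurIndicator (integral G) n V) := by
  classical
  let b := Module.finBasis ℂ V
  rw [frobeniusSchurIndicator, moduleCharacter, LinearMap.trace_eq_matrix_trace ℂ b]
  exact isIntegral_trace_sweedlerPow_integral ((LinearMap.toMatrixAlgEquiv b).toAlgHom.comp
    (Algebra.lsmul (A := DrinfeldDouble G) ℂ ℂ V)) hn

theorem isFSZ_of_commonRootCount_eq
    (hG : ∀ n, n ≠ 0 → ∀ u g g' : G, Subgroup.zpowers g = Subgroup.zpowers g' →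
      commonRootCount n u g = commonRootCount n u g') : IsFSZ.{u, v} G := by
  intro n hn V _ _ _ _ _
  have : Module.Finite ℂ V := Module.Finite.trans (DrinfeldDouble G) V
  obtain ⟨c, hc⟩ := card_mul_frobeniusSchurIndicator_mem_range_intCast V (hG n hn.ne')
  exact exists_int_eq_of_isIntegral (isIntegral_frobeniusSchurIndicator V hn.ne')
    Fintype.card_ne_zero ⟨c, hc.symm⟩

theorem isFSZ_of_centralizer_hasTorsionPowFibers
    (hG : ∀ n, n ≠ 0 → ∀ g : G, g ≠ 1 → HasTorsionPowFibers n (Subgroup.centralizer {g})) :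
    IsFSZ.{u, v} G := by
  refine isFSZ_of_commonRootCount_eq fun n hn u g g' hg => ?_
  by_cases hg1 : g = 1
  · obtain rfl : g' = g := by
      rw [hg1, Subgroup.zpowers_one_eq_bot, eq_comm, Subgroup.zpowers_eq_bot] at hg
      rw [hg, hg1]
    rfl
  · exact commonRootCount_eq_of_centralizer_hasTorsionPowFibers (hG n hn g hg1) u hg

end FSZ

end DrinfeldDouble

theorem mainTheorem10 (G : Type u) [Group G] [Fintype G] :
    (IsRegularCNGroup G → IsFSZ.{u, v} G) ∧ (IsRegularNilpotent G → IsFSZ.{u, v} G) := by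
  refine ⟨fun hCN => ?_, fun hnil => ?_⟩
  · exact DrinfeldDouble.isFSZ_of_centralizer_hasTorsionPowFibers fun n hn g hg =>
      (hCN g hg).hasTorsionPowFibers hn
  · exact DrinfeldDouble.isFSZ_of_centralizer_hasTorsionPowFibers fun n hn g _ =>
      (hnil.hasTorsionPowFibers hn).of_injective (Subgroup.centralizer {g}).subtype_injective
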